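/- Covering is played on a graph $G$ by a robber and a team of cops with perfect information. The robber's starting vertex is given, and the cops, knowing it, choose their starting vertices so that one of them is at the robber's vertex (several cops may share a vertex). Then the robber and the cops move alternately, the robber first: in his turn the robber moves to any vertex at graph distance at most $2$ from his current vertex, and in their turn each cop stays put or moves to an adjacent vertex. The cops win if, whatever the robber does, after every one of their turns some cop is at the robber's vertex. We say that $k$ cops can win Covering on $G$ if, for every starting vertex of the robber, $k$ cops have a strategy that wins. Let $[n]^2$ be the grid with the $\ell_\infty$ metric, that is, the graph on $\{1,\dots,n\}^2$ in which two distinct vertices are adjacent if each coordinate differs by at most $1$. **Theorem.** $O(n^{1.999})$ cops can win Covering on $[n]^2$: there is a constant $C>0$ such that for every $n$ there is an integer $k$ with $0\le k\le C n^{1.999}$ such that $k$ cops can win Covering on $[n]^2$. In particular $o(n^2)$ cops can win: for every $\varepsilon>0$ and all sufficiently large $n$, there is an integer $k$ with $0\le k\le\varepsilon n^2$ such that $k$ cops can win Covering on $[n]^2$. -/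

import Mathlib

/-- The two-dimensional grid `[n]²` with the `ℓ_∞` metric: two distinct vertices are adjacent
when each coordinate differs by at most `1`. -/
def gridGraph (n : ℕ) : SimpleGraph (Fin n × Fin n) where
  Adj u v := u ≠ v ∧ |((u.1 : ℕ) : ℤ) - ((v.1 : ℕ) : ℤ)| ≤ 1 ∧
    |((u.2 : ℕ) : ℤ) - ((v.2 : ℕ) : ℤ)| ≤ 1
  symm := ⟨fun _ _ h => ⟨h.1.symm, by rw [abs_sub_comm]; exact h.2.1,
    by rw [abs_sub_comm]; exact h.2.2⟩⟩
  loopless := ⟨fun _ h => h.1 rfl⟩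

/-- A legal infinite play of a robber of speed `s`: `r t` is his vertex after his `t`-th move
(`r 0` is his starting vertex), and each move goes to a vertex at graph distance at most `s`. -/
def IsRobberPlay {V : Type*} (G : SimpleGraph V) (s : ℕ) (r : ℕ → V) : Prop :=
  ∀ t : ℕ, G.edist (r t) (r (t + 1)) ≤ (s : ℕ∞)

/-- What the cops have seen of the robber when they make their `t`-th move:
the list `[r 0, r 1, …, r t]`. -/
def robberHistory {V : Type*} (r : ℕ → V) (t : ℕ) : List V :=
  (List.range (t + 1)).map r

/-- `k` cops can win Covering on `G` against a robber of speed `s`.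
A strategy `σ` tells the cops where to stand after their turn, from the robber's positions so far.
Its value on `[r 0]` is the starting configuration, which the cops choose knowing `r 0`; after that
the robber and the cops alternate, the robber first. Against every legal robber play, each cop
stays put or moves to an adjacent vertex in each turn, and after each turn of the cops
some cop is at the robber's vertex. -/
def CopsWinCovering {V : Type*} (G : SimpleGraph V) (s k : ℕ) : Prop :=
  ∃ σ : List V → Fin k → V, ∀ r : ℕ → V, IsRobberPlay G s r →
    (∀ (t : ℕ) (i : Fin k),
      σ (robberHistory r (t + 1)) i = σ (robberHistory r t) i ∨
        G.Adj (σ (robberHistory r t) i) (σ (robberHistory r (t + 1)) i)) ∧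
    ∀ t : ℕ, ∃ i : Fin k, σ (robberHistory r t) i = r t

/-! One cop team in 256 can be saved at every scale. Cut a square of side `16 * l` into 256 blocks
and give each block but one, the hole, a team playing the game of side `l` against a 1-Lipschitz
image of the robber, his shadow. The team in his block catches him, so the hole must stay away from
him. In `l` turns he changes block by at most 2 in each coordinate. Teams far from him see a shadow
resting in a corner, so they can march rigidly to an adjacent block in that time; a whole line of
them marching at once carries the hole across the square (`exists_slide`). Thus side `16 * l` costs
255 times side `l` (`CanCover.mul_sixteen`), and `255 < 16 ^ 1.999`. -/

/-- The two points are at `ℓ_∞` distance at most `d`. -/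
def Near (d : ℤ) (u v : ℤ × ℤ) : Prop := |u.1 - v.1| ≤ d ∧ |u.2 - v.2| ≤ d

/-- The two points are at `ℓ_∞` distance at least `d`. -/
def Far (d : ℤ) (u v : ℤ × ℤ) : Prop := d ≤ |u.1 - v.1| ∨ d ≤ |u.2 - v.2|

/-- The point lies in the square `{0, …, n - 1}²`. -/
def InBox (n : ℤ) (v : ℤ × ℤ) : Prop := (0 ≤ v.1 ∧ v.1 < n) ∧ (0 ≤ v.2 ∧ v.2 < n)

/-- Cops indexed by `ι` can maintain Covering against a robber of speed `2` in the square
`{0, …, n - 1}²`: there is a set of winning positions, stable under the robber's moves. The cops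
may leave the square. -/
def CanCover (n : ℤ) (ι : Type) : Prop :=
  ∃ W : ℤ × ℤ → (ι → ℤ × ℤ) → Prop,
    (∀ v, InBox n v → ∃ c, W v c) ∧
    (∀ v c, W v c → ∃ i, c i = v) ∧
    ∀ v w c, W v c → InBox n w → Near 2 v w → ∃ c', W w c' ∧ ∀ i, Near 1 (c i) (c' i)

theorem Near.refl {d : ℤ} (hd : 0 ≤ d) (u : ℤ × ℤ) : Near d u u := by
  simp [Near, hd]

theorem CanCover.congr {n : ℤ} {ι κ : Type} (e : ι ≃ κ) (h : CanCover n ι) : CanCover n κ := by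
  obtain ⟨W, h0, h1, h2⟩ := h
  refine ⟨fun v c => W v (c ∘ e), fun v hv => ?_, fun v c hc => ?_, fun v w c hc hw hvw => ?_⟩
  · obtain ⟨c, hc⟩ := h0 v hv
    exact ⟨c ∘ e.symm, by simpa [Function.comp_assoc] using hc⟩
  · obtain ⟨i, hi⟩ := h1 v _ hc
    exact ⟨e i, hi⟩
  · obtain ⟨c', hc', hn⟩ := h2 v w _ hc hw hvw
    refine ⟨c' ∘ e.symm, by simpa [Function.comp_assoc] using hc', fun i => ?_⟩
    simpa using hn (e.symm i)

theorem canCover_one : CanCover 1 (Fin 1) := by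
  refine ⟨fun v c => v = 0 ∧ c = fun _ => 0, fun v hv => ⟨_, ?_, rfl⟩, ?_, ?_⟩
  · obtain ⟨⟨h1, h2⟩, h3, h4⟩ := hv
    exact Prod.ext (show v.1 = 0 by omega) (show v.2 = 0 by omega)
  · rintro v c ⟨rfl, rfl⟩
    exact ⟨0, rfl⟩
  · rintro v w c ⟨rfl, rfl⟩ ⟨⟨h1, h2⟩, h3, h4⟩ -
    exact ⟨_, ⟨Prod.ext (show w.1 = 0 by omega) (show w.2 = 0 by omega), rfl⟩,
      fun _ => Near.refl zero_le_one _⟩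

/-! ### Shadows

`shadow l` retracts the plane onto the square of side `l`. It is `1`-Lipschitz and sends every
point at distance at least `l - 1` from the square to the corner `0`. -/

/-- The image of the robber in the square `{0, …, l - 1}²`. -/
def shadow (l : ℤ) (u : ℤ × ℤ) : ℤ × ℤ :=
  -- Outside the square, `r` is `l - 1` minus the distance to it; capping the coordinates by `r`
  -- pulls the image to the corner as the robber recedes.
  let r := min (min (l - 1 + u.1) (2 * (l - 1) - u.1)) (min (l - 1 + u.2) (2 * (l - 1) - u.2))
  (max 0 (min (min (l - 1) u.1) r), max 0 (min (min (l - 1) u.2) r))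

theorem shadow_inBox {l : ℤ} (hl : 1 ≤ l) (u : ℤ × ℤ) : InBox l (shadow l u) := by
  simp only [InBox, shadow]
  omega

theorem shadow_of_inBox {l : ℤ} {u : ℤ × ℤ} (hu : InBox l u) : shadow l u = u := by
  simp only [InBox] at hu
  refine Prod.ext ?_ ?_ <;> simp only [shadow] <;> omega

theorem shadow_near {l : ℤ} {u v : ℤ × ℤ} (h : Near 2 u v) :
    Near 2 (shadow l u) (shadow l v) := by
  have hmin : ∀ {a b x y : ℤ}, |a - x| ≤ 2 → |b - y| ≤ 2 → |min a b - min x y| ≤ 2 :=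
    fun h₁ h₂ => (abs_min_sub_min_le_max _ _ _ _).trans (max_le h₁ h₂)
  have hmax : ∀ {a x : ℤ}, |a - x| ≤ 2 → |max 0 a - max 0 x| ≤ 2 :=
    fun h₁ => (abs_max_sub_max_le_max _ _ _ _).trans (max_le (by simp) h₁)
  have hadd : ∀ {a x : ℤ}, |a - x| ≤ 2 → |l - 1 + a - (l - 1 + x)| ≤ 2 := by simp
  have hsub : ∀ {a x : ℤ}, |a - x| ≤ 2 → |2 * (l - 1) - a - (2 * (l - 1) - x)| ≤ 2 := by
    intro a x h
    rwa [sub_sub_sub_cancel_left, abs_sub_comm]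
  have hr := hmin (hmin (hadd h.1) (hsub h.1)) (hmin (hadd h.2) (hsub h.2))
  have hconst : |(l - 1) - (l - 1)| ≤ 2 := by simp
  exact ⟨hmax (hmin (hmin hconst h.1) hr), hmax (hmin (hmin hconst h.2) hr)⟩

/-- The block of side `l` containing the point. -/
def block (l : ℤ) (p : ℤ × ℤ) : ℤ × ℤ := (p.1 / l, p.2 / l)

/-- The position of the point relative to the corner of the block `Q` of side `l`. -/
def rel (l : ℤ) (Q p : ℤ × ℤ) : ℤ × ℤ := (p.1 - l * Q.1, p.2 - l * Q.2)

theorem rel_near {l d : ℤ} {p q : ℤ × ℤ} (Q : ℤ × ℤ) (h : Near d p q) :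
    Near d (rel l Q p) (rel l Q q) := by
  simpa [Near, rel] using h

theorem rel_block_inBox {l : ℤ} (hl : 1 ≤ l) (p : ℤ × ℤ) : InBox l (rel l (block l p) p) := by
  simp only [InBox, rel, block]
  refine ⟨?_, ?_⟩ <;>
  · rw [← Int.emod_def]
    exact ⟨Int.emod_nonneg _ (by omega), Int.emod_lt_of_pos _ (by omega)⟩

theorem block_inBox {l m : ℤ} (hl : 1 ≤ l) {p : ℤ × ℤ} (hp : InBox (m * l) p) :
    InBox m (block l p) := by
  obtain ⟨⟨h1, h2⟩, h3, h4⟩ := hp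
  have hl' : 0 < l := by omega
  exact ⟨⟨Int.ediv_nonneg h1 hl'.le, Int.ediv_lt_of_lt_mul hl' h2⟩,
    Int.ediv_nonneg h3 hl'.le, Int.ediv_lt_of_lt_mul hl' h4⟩

theorem abs_ediv_sub_ediv_le {l m a b : ℤ} (hl : 1 ≤ l) (h : |a - b| ≤ m * l) :
    |a / l - b / l| ≤ m := by
  rw [abs_le] at h
  have h1 : a / l ≤ (b + m * l) / l := Int.ediv_le_ediv (by omega) (by omega)
  have h2 : b / l ≤ (a + m * l) / l := Int.ediv_le_ediv (by omega) (by omega)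
  rw [Int.add_mul_ediv_right _ _ (by omega)] at h1 h2
  rw [abs_le]
  omega

theorem block_near {l m : ℤ} (hl : 1 ≤ l) {p q : ℤ × ℤ} (h : Near (m * l) p q) :
    Near m (block l p) (block l q) :=
  ⟨abs_ediv_sub_ediv_le hl h.1, abs_ediv_sub_ediv_le hl h.2⟩

theorem Far.of_near {d e : ℤ} {u v w : ℤ × ℤ} (h : Far (d + e) u w) (h' : Near e u v) :
    Far d v w := by
  simp only [Far, Near, le_abs, abs_le] at *
  omega

theorem sub_mul_of_far {l a b : ℤ} (hl : 1 ≤ l) (h : 2 ≤ |a / l - b|) :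
    a - l * b ≤ -(l - 1) ∨ 2 * (l - 1) ≤ a - l * b := by
  have h1 := Int.mul_ediv_add_emod a l
  have h2 := Int.emod_nonneg a (show l ≠ 0 by omega)
  have h3 := Int.emod_lt_of_pos a (show 0 < l by omega)
  rcases le_abs.1 h with h | h
  · right
    nlinarith
  · left
    nlinarith

/-- A full block separates the robber from `Q`, so the cap in `shadow` is at most `0`. -/
theorem shadow_rel_of_far {l : ℤ} (hl : 1 ≤ l) {p Q : ℤ × ℤ} (h : Far 2 (block l p) Q) :
    shadow l (rel l Q p) = 0 := by
  generalize hu : rel l Q p = u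
  have h' : (u.1 ≤ -(l - 1) ∨ 2 * (l - 1) ≤ u.1) ∨ (u.2 ≤ -(l - 1) ∨ 2 * (l - 1) ≤ u.2) := by
    subst hu
    exact h.imp (sub_mul_of_far hl) (sub_mul_of_far hl)
  refine Prod.ext ?_ ?_ <;> simp only [shadow, Prod.fst_zero, Prod.snd_zero] <;> omega

/-! ### Sliding the hole -/

/-- Shifting the points between `a` and `b` one step towards `a` fills the hole at `a` and opens one
at `b`. -/
theorem exists_slide_line {m : ℤ} (a : ℤ) {b : ℤ} (hb : 0 ≤ b ∧ b < m) :
    ∃ g : ℤ → ℤ, (∀ x, |x - g x| ≤ 1) ∧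
      ∀ x, 0 ≤ x ∧ x < m → x ≠ b → ∃ y, (0 ≤ y ∧ y < m) ∧ y ≠ a ∧ g y = x := by
  refine ⟨fun x => if a < x ∧ x ≤ b then x - 1 else if b ≤ x ∧ x < a then x + 1 else x,
    fun x => ?_, fun x hx hxb => ?_⟩
  · rw [abs_le]
    dsimp only
    split_ifs <;> omega
  · dsimp only
    rcases lt_trichotomy a b with h | h | h
    · by_cases h' : a ≤ x ∧ x < b
      · exact ⟨x + 1, by omega, by omega, by split_ifs <;> omega⟩
      · exact ⟨x, by omega, by omega, by split_ifs <;> omega⟩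
    · exact ⟨x, by omega, by omega, by split_ifs <;> omega⟩
    · by_cases h' : b < x ∧ x ≤ a
      · exact ⟨x - 1, by omega, by omega, by split_ifs <;> omega⟩
      · exact ⟨x, by omega, by omega, by split_ifs <;> omega⟩

/-- The `8` pays for the two blocks the robber may gain in a phase, leaving the `6` that
`exists_slide` needs. -/
theorem exists_far_end (x : ℤ) : ∃ b : ℤ, (0 ≤ b ∧ b < 16) ∧ 8 ≤ |x - b| := by
  simp only [le_abs]
  by_cases h : x ≤ 7
  · exact ⟨15, by omega, by omega⟩
  · exact ⟨0, by omega, by omega⟩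

/-- If the robber is in block `P` and the hole `h` is far from him, then one step of the teams,
each to an adjacent block, takes the hole to a block that is even farther from the robber, and no
team moves near him. -/
theorem exists_slide {P h : ℤ × ℤ} (hh : InBox 16 h) (hfar : Far 6 P h) :
    ∃ (h' : ℤ × ℤ) (f : ℤ × ℤ → ℤ × ℤ), InBox 16 h' ∧ Far 8 P h' ∧ (∀ Q, Near 1 Q (f Q)) ∧
      (∀ Q, f Q ≠ Q → Far 6 P Q ∧ Far 6 P (f Q)) ∧
      ∀ Q, InBox 16 Q → Q ≠ h' → ∃ Q', InBox 16 Q' ∧ Q' ≠ h ∧ f Q' = Q := by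
  obtain ⟨h1, h2⟩ := h
  rcases hfar with hfar | hfar <;> dsimp only at hfar
  -- Fixing the coordinate in which the hole is far gives a line that is far from `P` throughout;
  -- the hole slides along it to an end far in the other coordinate.
  · obtain ⟨b, hb, hbP⟩ := exists_far_end P.2
    obtain ⟨g, hg, hgs⟩ := exists_slide_line h2 hb
    refine ⟨(h1, b), fun Q => if Q.1 = h1 then (Q.1, g Q.2) else Q, ⟨hh.1, hb⟩, Or.inr hbP,
      fun Q => ?_, fun Q hQ => ?_, fun Q hQ hne => ?_⟩
    · dsimp only
      split_ifs with hc
      · exact ⟨by simp, hg _⟩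
      · exact Near.refl zero_le_one _
    · dsimp only at hQ ⊢
      split_ifs at hQ ⊢ with hc
      · subst hc
        exact ⟨Or.inl hfar, Or.inl hfar⟩
      · exact absurd rfl hQ
    · by_cases hc : Q.1 = h1
      · subst hc
        obtain ⟨y, hy, hya, hyx⟩ := hgs Q.2 hQ.2 fun e => hne (Prod.ext rfl e)
        exact ⟨(Q.1, y), ⟨hQ.1, hy⟩, fun e => hya (congrArg Prod.snd e), by simp [hyx]⟩
      · exact ⟨Q, hQ, fun e => hc (congrArg Prod.fst e), by simp [hc]⟩
  · obtain ⟨b, hb, hbP⟩ := exists_far_end P.1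
    obtain ⟨g, hg, hgs⟩ := exists_slide_line h1 hb
    refine ⟨(b, h2), fun Q => if Q.2 = h2 then (g Q.1, Q.2) else Q, ⟨hb, hh.2⟩, Or.inl hbP,
      fun Q => ?_, fun Q hQ => ?_, fun Q hQ hne => ?_⟩
    · dsimp only
      split_ifs with hc
      · exact ⟨hg _, by simp⟩
      · exact Near.refl zero_le_one _
    · dsimp only at hQ ⊢
      split_ifs at hQ ⊢ with hc
      · subst hc
        exact ⟨Or.inr hfar, Or.inr hfar⟩
      · exact absurd rfl hQ
    · by_cases hc : Q.2 = h2
      · subst hc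
        obtain ⟨y, hy, hya, hyx⟩ := hgs Q.1 hQ.1 fun e => hne (Prod.ext e rfl)
        exact ⟨(y, Q.2), ⟨hy, hQ.2⟩, fun e => hya (congrArg Prod.fst e), by simp [hyx]⟩
      · exact ⟨Q, hQ, fun e => hc (congrArg Prod.snd e), by simp [hc]⟩

theorem exists_teams {h : ℤ × ℤ} (hh : InBox 16 h) :
    ∃ B : Fin 255 → ℤ × ℤ, ∀ Q, InBox 16 Q → Q ≠ h → ∃ i, B i = Q := by
  let s : Finset (ℤ × ℤ) := (Finset.Ico 0 16 ×ˢ Finset.Ico 0 16).erase h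
  have hs : s.card = 255 := by
    rw [Finset.card_erase_of_mem, Finset.card_product]
    · simp
    · simpa [InBox] using hh
  refine ⟨fun i => ((s.equivFinOfCardEq hs).symm i).1, fun Q hQ hne => ?_⟩
  have hQs : Q ∈ s := by simpa [s, InBox, hne] using hQ
  exact ⟨s.equivFinOfCardEq hs ⟨Q, hQs⟩, by simp⟩

/-! ### The recursive step -/

/-- Winning positions for the square of side `16 * l`, which is cut into `16 × 16` blocks of side
`l`. There are `255` teams, each playing in a block against the shadow of the robber there.
`t` steps ago the robber was at `p₀` and the teams set out from the blocks `B` towards the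
blocks `B'`, which leave only the block `h` without a team. -/
structure TeamPosition (l : ℤ) {ι : Type} (W : ℤ × ℤ → (ι → ℤ × ℤ) → Prop) (t : ℤ)
    (p : ℤ × ℤ) (C : Fin 255 × ι → ℤ × ℤ) (p₀ h : ℤ × ℤ) (B B' : Fin 255 → ℤ × ℤ)
    (c : Fin 255 → ι → ℤ × ℤ) : Prop where
  robber : InBox (16 * l) p
  time_nonneg : 0 ≤ t
  time_le : t ≤ l
  near : Near (2 * t) p₀ p
  hole : InBox 16 h
  hole_far : Far 8 (block l p₀) h
  step : ∀ i, Near 1 (B i) (B' i)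
  moving : ∀ i, B' i ≠ B i → Far 6 (block l p₀) (B i) ∧ Far 6 (block l p₀) (B' i)
  cover : ∀ Q, InBox 16 Q → Q ≠ h → ∃ i, B' i = Q
  win : ∀ i, W (shadow l (rel l (B i) p)) (c i)
  -- The frame of a team moves linearly from block `B i` to `B' i` in `l` turns; `c i` is the
  -- position in that frame.
  pos : ∀ i j, C (i, j) = (l * (B i).1 + t * ((B' i).1 - (B i).1) + (c i j).1,
    l * (B i).2 + t * ((B' i).2 - (B i).2) + (c i j).2)

section

variable {l : ℤ} {ι : Type} {W : ℤ × ℤ → (ι → ℤ × ℤ) → Prop} {t : ℤ} {p : ℤ × ℤ}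
  {C : Fin 255 × ι → ℤ × ℤ} {p₀ h : ℤ × ℤ} {B B' : Fin 255 → ℤ × ℤ} {c : Fin 255 → ι → ℤ × ℤ}

theorem TeamPosition.block_near (H : TeamPosition l W t p C p₀ h B B' c) (hl : 1 ≤ l) :
    Near 2 (block l p₀) (block l p) := by
  have h1 := H.time_le
  exact _root_.block_near hl ⟨H.near.1.trans (by omega), H.near.2.trans (by omega)⟩

/-- A marching team has the same shadow in its old and new blocks, so its frozen `c i` wins in both.
-/
theorem TeamPosition.shadow_moving (H : TeamPosition l W t p C p₀ h B B' c) (hl : 1 ≤ l)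
    {i : Fin 255} (hi : B' i ≠ B i) :
    shadow l (rel l (B i) p) = 0 ∧ shadow l (rel l (B' i) p) = 0 := by
  have weaken : ∀ Q, Far 6 (block l p₀) Q → Far 2 (block l p) Q := fun Q hQ =>
    Far.of_near (e := 2) (hQ.imp (fun h => by omega) fun h => by omega) (H.block_near hl)
  exact ⟨shadow_rel_of_far hl (weaken _ (H.moving i hi).1),
    shadow_rel_of_far hl (weaken _ (H.moving i hi).2)⟩

/-- The robber's block is within 2 of `block l p₀`, so it is not the hole and its team is not
marching; the shadow there is the robber himself. -/
theorem TeamPosition.covered (H : TeamPosition l W t p C p₀ h B B' c) (hl : 1 ≤ l)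
    (hW : ∀ v c, W v c → ∃ i, c i = v) : ∃ i, C i = p := by
  have hnear := H.block_near hl
  have notFar : ∀ Q, Far 6 (block l p₀) Q → block l p ≠ Q := by
    rintro Q hQ rfl
    simp only [Far, Near, le_abs, abs_le] at hQ hnear
    omega
  obtain ⟨i, hi⟩ := H.cover (block l p) (block_inBox hl H.robber)
    (notFar _ (H.hole_far.imp (fun h => by omega) fun h => by omega))
  have hB : B' i = B i := by
    by_contra hne
    exact notFar _ (H.moving i hne).2 hi.symm
  obtain ⟨j, hj⟩ := hW _ _ (H.win i)
  rw [← hB, hi, shadow_of_inBox (rel_block_inBox hl p)] at hj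
  refine ⟨(i, j), ?_⟩
  rw [H.pos, hj, hB, ← hB, hi]
  simp [rel]

/-- When the teams have arrived, they can set out again. -/
theorem TeamPosition.restart (H : TeamPosition l W l p C p₀ h B B' c) (hl : 1 ≤ l) :
    ∃ h' B'', TeamPosition l W 0 p C p h' B' B'' c := by
  have hfar : Far 6 (block l p) h := Far.of_near (e := 2) H.hole_far (H.block_near hl)
  obtain ⟨h', f, hh', hfar', hf, hmov, hsurj⟩ := exists_slide H.hole hfar
  refine ⟨h', fun i => f (B' i), H.robber, le_rfl, by omega, Near.refl (by simp) _, hh', hfar',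
    fun i => hf _, fun i hi => hmov _ hi, fun Q hQ hne => ?_, fun i => ?_, fun i j => ?_⟩
  · obtain ⟨Q', hQ', hne', rfl⟩ := hsurj Q hQ hne
    obtain ⟨i, rfl⟩ := H.cover Q' hQ' hne'
    exact ⟨i, rfl⟩
  · by_cases hi : B' i = B i
    · rw [hi]
      exact H.win i
    · rw [(H.shadow_moving hl hi).2, ← (H.shadow_moving hl hi).1]
      exact H.win i
  · rw [H.pos]
    ext <;> simp <;> ring

/-- A resting team replies in its own game. A marching team has a constant shadow, so it spends its
whole move on the translation. -/
theorem TeamPosition.advance (H : TeamPosition l W t p C p₀ h B B' c) (hl : 1 ≤ l) (ht : t < l)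
    (hW : ∀ v w c, W v c → InBox l w → Near 2 v w → ∃ c', W w c' ∧ ∀ i, Near 1 (c i) (c' i))
    {q : ℤ × ℤ} (hq : InBox (16 * l) q) (hpq : Near 2 p q) :
    ∃ C' c', TeamPosition l W (t + 1) q C' p₀ h B B' c' ∧ ∀ i, Near 1 (C i) (C' i) := by
  have hp₀ : Near (2 * (t + 1)) p₀ q := by
    have h1 := H.near
    simp only [Near, abs_le] at h1 hpq ⊢
    omega
  have hblock : Near 2 (block l p₀) (block l q) :=
    _root_.block_near hl ⟨hp₀.1.trans (by omega), hp₀.2.trans (by omega)⟩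
  have hex : ∀ i, ∃ c', W (shadow l (rel l (B i) q)) c' ∧ (∀ j, Near 1 (c i j) (c' j)) ∧
      (B' i ≠ B i → c' = c i) := by
    intro i
    by_cases hi : B' i = B i
    · obtain ⟨c', h1, h2⟩ := hW _ _ _ (H.win i) (shadow_inBox hl _)
        (shadow_near (rel_near (B i) hpq))
      exact ⟨c', h1, h2, fun h => absurd hi h⟩
    · refine ⟨c i, ?_, fun j => Near.refl zero_le_one _, fun _ => rfl⟩
      have hfar : Far 2 (block l q) (B i) := Far.of_near (e := 2)
        ((H.moving i hi).1.imp (fun h => by omega) fun h => by omega) hblock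
      rw [shadow_rel_of_far hl hfar, ← (H.shadow_moving hl hi).1]
      exact H.win i
  choose c' hc' hcn hcm using hex
  refine ⟨fun i => (l * (B i.1).1 + (t + 1) * ((B' i.1).1 - (B i.1).1) + (c' i.1 i.2).1,
    l * (B i.1).2 + (t + 1) * ((B' i.1).2 - (B i.1).2) + (c' i.1 i.2).2), c',
    ⟨hq, by linarith [H.time_nonneg], by omega, hp₀, H.hole, H.hole_far, H.step, H.moving,
      H.cover, hc', fun i j => rfl⟩, ?_⟩
  rintro ⟨i, j⟩
  rw [H.pos]
  by_cases hi : B' i = B i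
  · have := hcn i j
    simpa [Near, hi] using this
  · have := H.step i
    dsimp only
    rw [hcm i hi]
    simp only [Near] at this ⊢
    convert this using 2 <;> congr 1 <;> ring

end

theorem CanCover.mul_sixteen {l : ℤ} (hl : 1 ≤ l) {ι : Type} (H : CanCover l ι) :
    CanCover (16 * l) (Fin 255 × ι) := by
  obtain ⟨W, hstart, hcov, hstep⟩ := H
  refine ⟨fun p C => ∃ t p₀ h B B' c, TeamPosition l W t p C p₀ h B B' c, fun p hp => ?_, ?_, ?_⟩
  · obtain ⟨b, hb, hbP⟩ := exists_far_end (block l p).1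
    have hh : InBox 16 (b, 0) := ⟨hb, by norm_num⟩
    obtain ⟨B, hB⟩ := exists_teams hh
    choose c hc using fun i => hstart (shadow l (rel l (B i) p)) (shadow_inBox hl _)
    -- The first phase has `B' = B`: no team marches.
    exact ⟨fun i => (l * (B i.1).1 + 0 * ((B i.1).1 - (B i.1).1) + (c i.1 i.2).1,
      l * (B i.1).2 + 0 * ((B i.1).2 - (B i.1).2) + (c i.1 i.2).2), 0, p, (b, 0), B, B, c, hp,
      le_rfl, by omega, Near.refl (by simp) _, hh, Or.inl hbP, fun i => Near.refl zero_le_one _,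
      fun i hi => absurd rfl hi, hB, hc, fun i j => rfl⟩
  · rintro p C ⟨t, p₀, h, B, B', c, H⟩
    exact H.covered hl hcov
  · rintro p q C ⟨t, p₀, h, B, B', c, H⟩ hq hpq
    rcases H.time_le.lt_or_eq with ht | rfl
    · obtain ⟨C', c', H', hC⟩ := H.advance hl ht hstep hq hpq
      exact ⟨C', ⟨_, _, _, _, _, _, H'⟩, hC⟩
    · obtain ⟨h', B'', H₀⟩ := H.restart hl
      obtain ⟨C', c', H', hC⟩ := H₀.advance hl (by omega) hstep hq hpq
      exact ⟨C', ⟨_, _, _, _, _, _, H'⟩, hC⟩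

theorem canCover_pow (j : ℕ) : CanCover (16 ^ j) (Fin (255 ^ j)) := by
  induction j with
  | zero => exact canCover_one
  | succ j ih =>
    have h := ih.mul_sixteen (one_le_pow₀ (by norm_num))
    rw [← pow_succ'] at h
    exact h.congr (finProdFinEquiv.trans (finCongr (pow_succ' 255 j).symm))

/-! ### From winning positions to strategies -/

/-- The nearest element of `Fin m` to an integer. -/
def clampFin (m : ℕ) (hm : 0 < m) (x : ℤ) : Fin m :=
  ⟨(max 0 (min x (m - 1))).toNat, by omega⟩

theorem clampFin_coe {m : ℕ} (hm : 0 < m) (x : Fin m) : clampFin m hm ((x : ℕ) : ℤ) = x := by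
  ext
  simp only [clampFin]
  omega

theorem clampFin_sub_le {m : ℕ} (hm : 0 < m) {x y : ℤ} (h : |x - y| ≤ 1) :
    |((clampFin m hm x : ℕ) : ℤ) - ((clampFin m hm y : ℕ) : ℤ)| ≤ 1 := by
  rw [abs_le] at h ⊢
  simp only [clampFin]
  omega

/-- The vertex of the grid as a point of the plane. -/
def gridPoint {m : ℕ} (v : Fin m × Fin m) : ℤ × ℤ := (((v.1 : ℕ) : ℤ), ((v.2 : ℕ) : ℤ))

theorem gridGraph_walk_near {m : ℕ} {u v : Fin m × Fin m} (w : (gridGraph m).Walk u v) :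
    Near w.length (gridPoint u) (gridPoint v) := by
  induction w with
  | nil => exact Near.refl (by simp) _
  | cons h _ ih =>
    rw [SimpleGraph.Walk.length_cons]
    obtain ⟨-, h1, h2⟩ := h
    push_cast
    simp only [Near, gridPoint, abs_le] at ih h1 h2 ⊢
    omega

theorem gridGraph_near_of_edist_le {m d : ℕ} {u v : Fin m × Fin m}
    (h : (gridGraph m).edist u v ≤ d) : Near d (gridPoint u) (gridPoint v) := by
  obtain ⟨w, hw⟩ := SimpleGraph.exists_walk_of_edist_ne_top
    (ne_top_of_le_ne_top (ENat.natCast_ne_top d) h)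
  rw [← hw, Nat.cast_le] at h
  have h' : (w.length : ℤ) ≤ d := by exact_mod_cast h
  exact ⟨(gridGraph_walk_near w).1.trans h', (gridGraph_walk_near w).2.trans h'⟩

theorem robberHistory_succ {V : Type*} (r : ℕ → V) (t : ℕ) :
    robberHistory r (t + 1) = robberHistory r t ++ [r (t + 1)] := by
  simp [robberHistory, List.range_succ]

/-- A set of winning positions, stable under the robber's moves, gives a winning strategy. -/
theorem copsWinCovering_of_positions {V : Type*} [Nonempty V] {G : SimpleGraph V} {s k : ℕ}
    {W : V → (Fin k → V) → Prop} (hstart : ∀ v, ∃ c, W v c)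
    (hcov : ∀ v c, W v c → ∃ i, c i = v)
    (hstep : ∀ v w c, W v c → G.edist v w ≤ s →
      ∃ c', W w c' ∧ ∀ i, c' i = c i ∨ G.Adj (c i) (c' i)) :
    CopsWinCovering G s k := by
  classical
  choose start hstart using hstart
  choose! next hnext hmove using hstep
  -- The chosen replies are folded over the history; the value at `[]` is irrelevant, as histories
  -- are nonempty.
  let play : List V → V × (Fin k → V) := fun h =>
    match h with
    | [] => (Classical.arbitrary V, fun _ => Classical.arbitrary V)
    | v :: h => h.foldl (fun a w => (w, next a.1 w a.2)) (v, start v)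
  have play_append : ∀ h w, h ≠ [] → play (h ++ [w]) = (w, next (play h).1 w (play h).2) := by
    rintro (_ | ⟨v, h⟩) w hne
    · exact absurd rfl hne
    · simp [play, List.foldl_append]
  have hist_ne : ∀ (r : ℕ → V) t, robberHistory r t ≠ [] := by
    intro r t
    simp [robberHistory]
  refine ⟨fun h => (play h).2, fun r hr => ?_⟩
  have inv : ∀ t, (play (robberHistory r t)).1 = r t ∧ W (r t) (play (robberHistory r t)).2 := by
    intro t
    induction t with
    | zero => exact ⟨rfl, hstart (r 0)⟩
    | succ t ih =>
      rw [robberHistory_succ, play_append _ _ (hist_ne r t), ih.1]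
      exact ⟨rfl, hnext _ _ _ ih.2 (hr t)⟩
  refine ⟨fun t i => ?_, fun t => hcov _ _ (inv t).2⟩
  dsimp only
  rw [robberHistory_succ, play_append _ _ (hist_ne r t), (inv t).1]
  exact hmove _ _ _ (inv t).2 (hr t) i

theorem CanCover.copsWinCovering {n m k : ℕ} (hm : 0 < m) (hmn : m ≤ n)
    (H : CanCover n (Fin k)) : CopsWinCovering (gridGraph m) 2 k := by
  obtain ⟨W, hstart, hcov, hstep⟩ := H
  have hbox : ∀ v : Fin m × Fin m, InBox n (gridPoint v) := by
    rintro ⟨a, b⟩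
    simp only [InBox, gridPoint]
    omega
  -- Clamping brings stray cops back into the grid, does not lengthen their steps, and fixes the
  -- robber's vertices.
  let proj : ℤ × ℤ → Fin m × Fin m := fun u => (clampFin m hm u.1, clampFin m hm u.2)
  have : Nonempty (Fin m × Fin m) := ⟨proj 0⟩
  refine copsWinCovering_of_positions
    (W := fun v c => ∃ c₀, W (gridPoint v) c₀ ∧ c = proj ∘ c₀) (fun v => ?_) ?_ ?_
  · obtain ⟨c, hc⟩ := hstart _ (hbox v)
    exact ⟨_, c, hc, rfl⟩
  · rintro v _ ⟨c, hc, rfl⟩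
    obtain ⟨i, hi⟩ := hcov _ _ hc
    exact ⟨i, by simp [proj, hi, gridPoint, clampFin_coe]⟩
  · rintro v w _ ⟨c, hc, rfl⟩ hvw
    obtain ⟨c', hc', hn⟩ := hstep _ _ _ hc (hbox w) (gridGraph_near_of_edist_le hvw)
    refine ⟨_, ⟨c', hc', rfl⟩, fun i => or_iff_not_imp_left.2 fun hne => ?_⟩
    exact ⟨fun e => hne e.symm, clampFin_sub_le hm (hn i).1, clampFin_sub_le hm (hn i).2⟩

theorem copsWinCovering_gridGraph_zero : CopsWinCovering (gridGraph 0) 2 0 :=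
  ⟨fun _ i => i.elim0, fun r _ => (r 0).1.elim0⟩

theorem copsWinCovering_gridGraph {n : ℕ} (hn : 0 < n) :
    CopsWinCovering (gridGraph n) 2 (255 ^ (Nat.log 16 n + 1)) := by
  refine CanCover.copsWinCovering (n := 16 ^ (Nat.log 16 n + 1)) hn
    (Nat.lt_pow_succ_log_self (by norm_num) n).le ?_
  have := canCover_pow (Nat.log 16 n + 1)
  exact_mod_cast this

/-! ### Estimates for the exponent -/

set_option exponentiation.threshold 8000 in
theorem le_sixteen_rpow : (255 : ℝ) ≤ (16 : ℝ) ^ (1.999 : ℝ) := by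
  -- The 1000th power turns the claim into the integer inequality `255 ^ 1000 ≤ 16 ^ 1999`.
  have h : (255 : ℝ) ^ 1000 ≤ ((16 : ℝ) ^ (1.999 : ℝ)) ^ 1000 := by
    rw [← Real.rpow_natCast ((16 : ℝ) ^ (1.999 : ℝ)), ← Real.rpow_mul (by norm_num),
      show (1.999 : ℝ) * (1000 : ℕ) = (1999 : ℕ) by norm_num, Real.rpow_natCast]
    norm_num
  exact le_of_pow_le_pow_left₀ (by norm_num) (by positivity) h

theorem pow_log_le_rpow {n : ℕ} (hn : 0 < n) :
    (255 : ℝ) ^ (Nat.log 16 n + 1) ≤ 255 * (n : ℝ) ^ (1.999 : ℝ) := by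
  rw [pow_succ']
  refine mul_le_mul_of_nonneg_left ?_ (by norm_num)
  calc (255 : ℝ) ^ Nat.log 16 n ≤ ((16 : ℝ) ^ (1.999 : ℝ)) ^ Nat.log 16 n :=
        pow_le_pow_left₀ (by norm_num) le_sixteen_rpow _
    _ = ((16 : ℝ) ^ Nat.log 16 n) ^ (1.999 : ℝ) := by
        rw [← Real.rpow_natCast, ← Real.rpow_natCast, ← Real.rpow_mul (by norm_num),
          ← Real.rpow_mul (by norm_num), mul_comm]
    _ ≤ (n : ℝ) ^ (1.999 : ℝ) := by
        refine Real.rpow_le_rpow (by positivity) ?_ (by norm_num)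
        exact_mod_cast Nat.pow_log_le_self 16 hn.ne'

theorem eventually_rpow_le {ε : ℝ} (hε : 0 < ε) :
    ∃ n₀ : ℕ, ∀ n : ℕ, n₀ ≤ n → 255 * (n : ℝ) ^ (1.999 : ℝ) ≤ ε * (n : ℝ) ^ 2 := by
  have h := (tendsto_rpow_neg_atTop (y := 0.001) (by norm_num)).comp
    (tendsto_natCast_atTop_atTop (R := ℝ))
  obtain ⟨n₀, hn₀⟩ := Filter.eventually_atTop.1
    (h.eventually (gt_mem_nhds (show 0 < ε / 255 by positivity)))
  -- The `+ 1` makes `n` positive, as splitting off `n ^ 2` from the power requires.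
  refine ⟨n₀ + 1, fun n hn => ?_⟩
  have hpos : (0 : ℝ) < n := by exact_mod_cast (show 0 < n by omega)
  have hle : (n : ℝ) ^ (-0.001 : ℝ) < ε / 255 := hn₀ n (by omega)
  rw [show (1.999 : ℝ) = -0.001 + (2 : ℕ) by norm_num, Real.rpow_add_natCast hpos.ne',
    ← mul_assoc]
  exact mul_le_mul_of_nonneg_right (by linarith) (by positivity)

theorem theorem1p2 :
    (∃ C : ℝ, 0 < C ∧ ∀ n : ℕ, ∃ k : ℕ,
      (k : ℝ) ≤ C * (n : ℝ) ^ (1.999 : ℝ) ∧ CopsWinCovering (gridGraph n) 2 k) ∧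
    (∀ ε : ℝ, 0 < ε → ∃ n₀ : ℕ, ∀ n : ℕ, n₀ ≤ n → ∃ k : ℕ,
      (k : ℝ) ≤ ε * (n : ℝ) ^ 2 ∧ CopsWinCovering (gridGraph n) 2 k) := by
  have main : ∀ n : ℕ, ∃ k : ℕ,
      (k : ℝ) ≤ 255 * (n : ℝ) ^ (1.999 : ℝ) ∧ CopsWinCovering (gridGraph n) 2 k := by
    intro n
    rcases n.eq_zero_or_pos with rfl | hn
    · exact ⟨0, by norm_num, copsWinCovering_gridGraph_zero⟩
    · exact ⟨_, by exact_mod_cast pow_log_le_rpow hn, copsWinCovering_gridGraph hn⟩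
  refine ⟨⟨255, by norm_num, main⟩, fun ε hε => ?_⟩
  obtain ⟨n₀, hn₀⟩ := eventually_rpow_le hε
  refine ⟨n₀, fun n hn => ?_⟩
  obtain ⟨k, hk, hwin⟩ := main n
  exact ⟨k, hk.trans (hn₀ n hn), hwin⟩
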